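/- For an $n\times n$ complex matrix $A$, $\lambda\in\mathbb C$ and an integer $m\ge 1$, let $$\eta_m(A,\lambda)=\dim\operatorname{Ker}(\lambda E-A)^m-\dim\operatorname{Ker}(\lambda E-A)^{m-1}$$ (the number of $\lambda$-Jordan blocks of $A$ of size at least $m$), where $E$ is the identity matrix. The family $(\eta_m(A,\lambda))_{m\ge 1,\,\lambda\in\mathbb C}$ is called the Weyr characteristic of $A$. Theorem 2. Let $A$ be an $n\times n$ complex matrix and let $k\ge 0$ be an integer. As $R$ ranges over all $n\times n$ complex matrices of rank at most $k$, the Weyr characteristics of the matrices $B=A+R$ are precisely the families $(\eta_m(\lambda))_{m\ge 1,\,\lambda\in\mathbb C}$ of non-negative integers, only finitely many of them nonzero and with $\eta_{m+1}(\lambda)\le\eta_m(\lambda)$ for all $m\ge 1$ and $\lambda\in\mathbb C$, that satisfy both of the following conditions: 1. $|\eta_m(A,\lambda)-\eta_m(\lambda)|\le k$ for all $\lambda\in\mathbb C$ and all $m\ge 1$; 2. $\sum_{\lambda\in\mathbb C}\sum_{m\ge 1}\eta_m(\lambda)=n$. -/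

import Mathlib

/-- The kernel of `(c E - A) ^ m`, as a subspace of `ℂⁿ`. -/
noncomputable def kerPow {n : ℕ} (A : Matrix (Fin n) (Fin n) ℂ) (m : ℕ) (c : ℂ) :
    Submodule ℂ (Fin n → ℂ) :=
  LinearMap.ker (Matrix.toLin' ((c • (1 : Matrix (Fin n) (Fin n) ℂ) - A) ^ m))

/-- The Weyr characteristic
`η_m(A, c) = dim Ker (c E - A) ^ m - dim Ker (c E - A) ^ (m - 1)`, `m = 1, 2, …`.
The kernels increase with `m`, so the subtraction of natural numbers does not truncate
(see `weyr_cast`). -/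
noncomputable def weyr {n : ℕ} (A : Matrix (Fin n) (Fin n) ℂ) (m : ℕ+) (c : ℂ) : ℕ :=
  Module.finrank ℂ (kerPow A (m : ℕ) c) - Module.finrank ℂ (kerPow A ((m : ℕ) - 1) c)

theorem weyr_cast {n : ℕ} (A : Matrix (Fin n) (Fin n) ℂ) (m : ℕ+) (c : ℂ) :
    (weyr A m c : ℤ) = (Module.finrank ℂ (kerPow A (m : ℕ) c) : ℤ) -
      (Module.finrank ℂ (kerPow A ((m : ℕ) - 1) c) : ℤ) := by
  have hle : kerPow A ((m : ℕ) - 1) c ≤ kerPow A (m : ℕ) c := by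
    intro v hv
    have hm : (m : ℕ) = ((m : ℕ) - 1) + 1 := by have := m.pos; omega
    unfold kerPow at hv ⊢
    rw [LinearMap.mem_ker, Matrix.toLin'_apply] at hv ⊢
    rw [hm, pow_succ', ← Matrix.mulVec_mulVec, hv, Matrix.mulVec_zero]
  have h := Submodule.finrank_mono hle
  unfold weyr
  omega

/-- The space of Weyr characteristics of total sum `n`: families `η_m(c)` of natural numbers
(`m ≥ 1`, `c ∈ ℂ`) with finite support and total sum `n`, nonincreasing in `m`. -/
structure IsWeyrCharacteristic (n : ℕ) (η : ℕ+ → ℂ → ℕ) : Prop where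
  finite_support : {p : ℕ+ × ℂ | η p.1 p.2 ≠ 0}.Finite
  antitone : ∀ (m : ℕ+) (c : ℂ), η (m + 1) c ≤ η m c
  sum_eq : ∑ᶠ p : ℕ+ × ℂ, η p.1 p.2 = n

/-!
The kernels of `(c - B) ^ m` describe `ℂⁿ`, viewed as a `ℂ[X]`-module through `B`, up to
isomorphism (`nonempty_linearEquiv_of_kerDim_eq`): by the structure theorem it is a sum of
modules `ℂ[X] / (X - c) ^ e`, and `η_m(c)` counts those summands with eigenvalue `c` and `e ≥ m`.
In particular Weyr characteristics are nonincreasing in `m`, finitely supported and have sum `n`.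

*Necessity* of the bound (`finrank_ker_pow_succ_le`). Let `N = c - A` and let `W` be the part of
`P = ker N ^ m` on which `R, R N, …, R N ^ (m - 1)` vanish; there the powers of `N` and `N - R`
agree. On `P / W` the map `N` has kernel of dimension at most `rank R`, since `R` is
injective on it; hence the cokernel of `N` on `P / W` has dimension at most `rank R` too, so
`W` fills `ker N ^ m / ker N ^ (m - 1)` up to that dimension.

*Sufficiency* reduces to rank one: given two Weyr characteristics of the same sum at distance
`k + 1`, there is a third at distance `1` from the first and `k` from the second
(`exists_intermediate`). It lies between integral bounds that enclose a weighted average of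
the two given ones, and it is found by raising the lower bound one unit at a time until the sum is
right.

For distance one, pass to invariant factors `f i` of `A` and `g i` of the target. The bound says
that `f (i + 1)` and `g (i + 1)` divide `h i = gcd (f i) (g i)`. Then `H = ∏ ℂ[X] / h i` embeds
into `F = ∏ ℂ[X] / f i` by `y i ↦ (f i / h i) • a i - a (i + 1)`, and the quotient is cyclic,
generated by `a 0` (`interlacingMap_injective`, `range_interlacingMap_sup_span`). The same holds
for `G = ∏ ℂ[X] / g i`. So `F` and `G` are both, as vector spaces, the sum of `H` and of
polynomials of degree less than a common `d = n - dim H`, and in these coordinates the two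
multiplications by `X` agree off the top power `X ^ (d - 1)`: they differ by rank at most one
(`exists_linearEquiv_finrank_range_le_one`).
-/

open Polynomial Module

/-! ### Kernel dimensions of finite-dimensional `K[X]`-modules -/

section KernelDimensions

variable {K : Type*} [Field K]

/-- The dimension over `K` of the kernel of `(X - c) ^ m` on a `K[X]`-module `M`. -/
noncomputable def kerDim (M : Type*) [AddCommGroup M] [Module K[X] M] [Module K M]
    [IsScalarTower K K[X] M] (m : ℕ) (c : K) : ℕ :=
  finrank K (Submodule.torsionBy K[X] M ((X - C c) ^ m))

theorem kerDim_congr {M N : Type*} [AddCommGroup M] [Module K[X] M] [Module K M]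
    [IsScalarTower K K[X] M] [AddCommGroup N] [Module K[X] N] [Module K N]
    [IsScalarTower K K[X] N] (e : M ≃ₗ[K[X]] N) (m : ℕ) (c : K) :
    kerDim M m c = kerDim N m c := by
  let p : K[X] := (X - C c) ^ m
  have h : (Submodule.torsionBy K[X] M p).map (e : M →ₗ[K[X]] N) =
      Submodule.torsionBy K[X] N p := by
    ext y
    simp only [Submodule.mem_map, Submodule.mem_torsionBy_iff, LinearEquiv.coe_coe]
    constructor
    · rintro ⟨x, hx, rfl⟩
      rw [← map_smul, hx, map_zero]
    · intro hy
      exact ⟨e.symm y, by rw [← map_smul, hy, map_zero], e.apply_symm_apply y⟩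
  exact ((e.submoduleMap _).trans (LinearEquiv.ofEq _ _ h)).restrictScalars K |>.finrank_eq

theorem kerDim_pi {ι : Type*} [Fintype ι] (M : ι → Type*) [∀ i, AddCommGroup (M i)]
    [∀ i, Module K[X] (M i)] [∀ i, Module K (M i)] [∀ i, IsScalarTower K K[X] (M i)]
    [∀ i, Module.Finite K (M i)] (m : ℕ) (c : K) :
    kerDim (∀ i, M i) m c = ∑ i, kerDim (M i) m c := by
  let p : K[X] := (X - C c) ^ m
  have hfin : ∀ i, Module.Finite K (Submodule.torsionBy K[X] (M i) p) := fun i =>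
    inferInstanceAs
      (Module.Finite K ((Submodule.torsionBy K[X] (M i) p).restrictScalars K))
  let e : Submodule.torsionBy K[X] (∀ i, M i) p ≃ₗ[K]
      ∀ i, Submodule.torsionBy K[X] (M i) p :=
    { toFun := fun x i => ⟨x.1 i, congrFun x.2 i⟩
      map_add' := fun _ _ => rfl
      map_smul' := fun _ _ => rfl
      invFun := fun y => ⟨fun i => (y i).1, funext fun i => (y i).2⟩
      left_inv := fun _ => rfl
      right_inv := fun _ => rfl }
  exact e.finrank_eq.trans (Module.finrank_pi_fintype K)

theorem finite_quotient_span {f : K[X]} (hf : f ≠ 0) :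
    Module.Finite K (K[X] ⧸ Ideal.span {f}) :=
  (AdjoinRoot.powerBasis hf).finite

/-- Multiplication by `q`, as a map `K[X] / h → K[X] / f` for `f ∣ q * h`. -/
noncomputable def mulQuot (q h f : K[X]) (hf : f ∣ q * h) :
    (K[X] ⧸ Ideal.span {h}) →ₗ[K[X]] (K[X] ⧸ Ideal.span {f}) :=
  Submodule.mapQ (Ideal.span {h}) (Ideal.span {f}) (LinearMap.lsmul K[X] K[X] q) (by
    intro x hx
    obtain ⟨y, rfl⟩ := Ideal.mem_span_singleton'.1 hx
    refine Ideal.mem_span_singleton.2 (hf.trans ?_)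
    exact ⟨y, by simp only [LinearMap.lsmul_apply, smul_eq_mul]; ring⟩)

theorem mulQuot_mk (q h f : K[X]) (hf : f ∣ q * h) (x : K[X]) :
    mulQuot q h f hf (Ideal.Quotient.mk _ x) = Ideal.Quotient.mk _ (q * x) := rfl

theorem mulQuot_injective {q h f : K[X]} (hq : q ≠ 0) (hf : f = q * h) :
    Function.Injective (mulQuot q h f hf.dvd) := by
  refine (injective_iff_map_eq_zero _).2 fun x hx => ?_
  obtain ⟨x, rfl⟩ := Ideal.Quotient.mk_surjective x
  rw [mulQuot_mk, Ideal.Quotient.eq_zero_iff_mem, Ideal.mem_span_singleton, hf] at hx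
  rw [Ideal.Quotient.eq_zero_iff_mem, Ideal.mem_span_singleton]
  exact (mul_dvd_mul_iff_left hq).1 hx

/-- With `f = (X - c) ^ a * g` and `d = min m a`, the kernel of `(X - c) ^ m` on `K[X] / f` is the
image of `K[X] / (X - c) ^ d` under multiplication by `(X - c) ^ (a - d) * g`. -/
theorem kerDim_quotient_span {f : K[X]} (hf : f ≠ 0) (m : ℕ) (c : K) :
    kerDim (K[X] ⧸ Ideal.span {f}) m c = min m (f.rootMultiplicity c) := by
  obtain ⟨g, hg, hgc⟩ := exists_eq_pow_rootMultiplicity_mul_and_not_dvd f hf c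
  set a := f.rootMultiplicity c
  set d := min m a with hd
  have hg0 : g ≠ 0 := by rintro rfl; exact hgc (dvd_zero _)
  have hX : (X - C c : K[X]) ≠ 0 := X_sub_C_ne_zero c
  have hfd : f = ((X - C c) ^ (a - d) * g) * (X - C c) ^ d := by
    calc f = (X - C c) ^ ((a - d) + d) * g := by rw [hg]; congr 2; omega
      _ = _ := by rw [pow_add]; ring
  have hq : (X - C c) ^ (a - d) * g ≠ 0 := mul_ne_zero (pow_ne_zero _ hX) hg0
  have hrange : LinearMap.range (mulQuot _ _ f hfd.dvd) =
      Submodule.torsionBy K[X] (K[X] ⧸ Ideal.span {f}) ((X - C c) ^ m) := by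
    ext y
    obtain ⟨y, rfl⟩ := Ideal.Quotient.mk_surjective y
    rw [Submodule.mem_torsionBy_iff, LinearMap.mem_range]
    have hsm : ((X - C c) ^ m : K[X]) • (Ideal.Quotient.mk (Ideal.span {f}) y) =
        Ideal.Quotient.mk (Ideal.span {f}) ((X - C c) ^ m * y) := rfl
    rw [hsm, Ideal.Quotient.eq_zero_iff_mem, Ideal.mem_span_singleton]
    constructor
    · rintro ⟨x, hx⟩
      obtain ⟨x, rfl⟩ := Ideal.Quotient.mk_surjective x
      rw [mulQuot_mk, Ideal.Quotient.mk_eq_mk_iff_sub_mem, Ideal.mem_span_singleton] at hx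
      have h1 : f ∣ (X - C c) ^ m * ((X - C c) ^ (a - d) * g * x) := by
        have : (X - C c) ^ m = (X - C c) ^ d * (X - C c) ^ (m - d) := by
          rw [← pow_add]; congr 1; omega
        rw [this]
        conv_lhs => rw [hfd]
        exact ⟨(X - C c) ^ (m - d) * x, by ring⟩
      have h2 := (dvd_sub h1 (hx.mul_left ((X - C c) ^ m)))
      rwa [← mul_sub, sub_sub_cancel] at h2
    · intro hy
      have hdvd : (X - C c) ^ (a - d) * g ∣ y := by
        rcases le_total m a with h | h
        · have hdm : d = m := min_eq_left h
          rw [hfd, mul_comm, hdm] at hy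
          rw [hdm]
          exact (mul_dvd_mul_iff_left (pow_ne_zero _ hX)).1 hy
        · have hda : d = a := min_eq_right h
          rw [hda, Nat.sub_self, pow_zero, one_mul]
          have hcop : IsCoprime g ((X - C c) ^ m) :=
            (((irreducible_X_sub_C c).coprime_iff_not_dvd.2 hgc).pow_left).symm
          exact hcop.dvd_of_dvd_mul_left ((Dvd.intro_left _ hg.symm).trans hy)
      obtain ⟨x, rfl⟩ := hdvd
      exact ⟨Ideal.Quotient.mk _ x, rfl⟩
  unfold kerDim
  rw [← hrange]
  have e := (LinearEquiv.ofInjective _ (mulQuot_injective hq hfd)).restrictScalars K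
  rw [← e.finrank_eq, finrank_quotient_span_eq_natDegree, natDegree_pow, natDegree_X_sub_C,
    mul_one]

theorem rootMultiplicity_X_sub_C_pow_apply [DecidableEq K] (b c : K) (e : ℕ) :
    ((X - C b) ^ e : K[X]).rootMultiplicity c = if b = c then e else 0 := by
  split_ifs with h
  · rw [h, rootMultiplicity_X_sub_C_pow]
  · refine rootMultiplicity_eq_zero ?_
    rw [IsRoot, eval_pow, eval_sub, eval_X, eval_C]
    exact pow_ne_zero _ (sub_ne_zero.2 (Ne.symm h))

end KernelDimensions

/-! ### Jordan decomposition -/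

section Jordan

universe u

variable {K : Type u} [Field K]

/-- Cayley–Hamilton for multiplication by `X` on a finite-dimensional `K[X]`-module. -/
theorem charpoly_lsmul_X_smul {M : Type*} [AddCommGroup M] [Module K[X] M]
    [Module K M] [IsScalarTower K K[X] M] [Module.Finite K M] (x : M) :
    LinearMap.charpoly (Algebra.lsmul K K M (X : K[X]) : Module.End K M) • x = 0 := by
  set T : Module.End K M := Algebra.lsmul K K M (X : K[X]) with hT
  have h : aeval T T.charpoly = Algebra.lsmul K K M T.charpoly := by
    conv_lhs => rw [hT, aeval_algHom_apply, aeval_X_left_apply]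
  rw [T.aeval_self_charpoly] at h
  exact (congrArg (fun S : Module.End K M => S x) h).symm

theorem isTorsion_of_finiteDimensional (M : Type*) [AddCommGroup M] [Module K[X] M]
    [Module K M] [IsScalarTower K K[X] M] [Module.Finite K M] : Module.IsTorsion K[X] M :=
  fun {x} => ⟨⟨_, mem_nonZeroDivisors_of_ne_zero (LinearMap.charpoly_monic _).ne_zero⟩,
    charpoly_lsmul_X_smul (K := K) x⟩

/-- Jordan decomposition: the structure theorem over `K[X]`, with the trivial summands removed. -/
theorem exists_jordan_decomposition [IsAlgClosed K] (M : Type*) [AddCommGroup M] [Module K[X] M]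
    [Module K M] [IsScalarTower K K[X] M] [Module.Finite K M] :
    ∃ (ι : Type u) (_ : Fintype ι) (b : ι → K) (e : ι → ℕ), (∀ i, 0 < e i) ∧
      Nonempty (M ≃ₗ[K[X]] ∀ i, K[X] ⧸ Ideal.span {(X - C (b i)) ^ e i}) := by
  classical
  have : Module.Finite K[X] M := Module.Finite.of_restrictScalars_finite K K[X] M
  obtain ⟨ι, _, p, hp, e, ⟨E⟩⟩ :=
    equiv_directSum_of_isTorsion (isTorsion_of_finiteDimensional (K := K) M)
  have hb : ∀ i, ∃ b, Associated (p i) (X - C b) := fun i => by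
    obtain ⟨b, hb⟩ := IsAlgClosed.exists_root (p i) (hp i).degree_pos.ne'
    exact ⟨b, ((irreducible_X_sub_C b).associated_of_dvd (hp i) (dvd_iff_isRoot.2 hb)).symm⟩
  choose b hb using hb
  let F : (∀ i, K[X] ⧸ Ideal.span {p i ^ e i}) ≃ₗ[K[X]]
      ∀ i, K[X] ⧸ Ideal.span {(X - C (b i)) ^ e i} :=
    LinearEquiv.piCongrRight fun i => Submodule.quotEquivOfEq _ _
      (Ideal.span_singleton_eq_span_singleton.2 ((hb i).pow_pow))
  let E' : M ≃ₗ[K[X]] ∀ i, K[X] ⧸ Ideal.span {(X - C (b i)) ^ e i} :=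
    (E.trans (DirectSum.linearEquivFunOnFintype K[X] ι _)).trans F
  refine ⟨{i // 0 < e i}, inferInstance, fun i => b i, fun i => e i, fun i => i.2, ?_⟩
  suffices G : (∀ i, K[X] ⧸ Ideal.span {(X - C (b i)) ^ e i}) ≃ₗ[K[X]]
      ∀ i : {i // 0 < e i}, K[X] ⧸ Ideal.span {(X - C (b i)) ^ e i} from ⟨E'.trans G⟩
  refine LinearEquiv.ofBijective (LinearMap.pi fun i => LinearMap.proj i.1) ⟨?_, fun y => ?_⟩
  · refine (injective_iff_map_eq_zero _).2 fun x hx => funext fun i => ?_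
    by_cases hi : 0 < e i
    · exact congrFun hx ⟨i, hi⟩
    · obtain ⟨z, hz⟩ := Ideal.Quotient.mk_surjective (x i)
      rw [← hz, Pi.zero_apply, Ideal.Quotient.eq_zero_iff_mem, Ideal.mem_span_singleton,
        Nat.eq_zero_of_not_pos hi, pow_zero]
      exact one_dvd z
  · refine ⟨fun i => if hi : 0 < e i then y ⟨i, hi⟩ else 0, funext fun i => ?_⟩
    exact dif_pos i.2

theorem kerDim_jordan [DecidableEq K] {ι : Type*} [Fintype ι] (b : ι → K) (e : ι → ℕ) (m : ℕ)
    (c : K) : kerDim (∀ i, K[X] ⧸ Ideal.span {(X - C (b i)) ^ e i}) m c =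
      ∑ i, if b i = c then min m (e i) else 0 := by
  have hne : ∀ i, (X - C (b i)) ^ e i ≠ 0 := fun i => pow_ne_zero _ (X_sub_C_ne_zero _)
  have := fun i => finite_quotient_span (hne i)
  rw [kerDim_pi]
  refine Finset.sum_congr rfl fun i _ => ?_
  rw [kerDim_quotient_span (hne i), rootMultiplicity_X_sub_C_pow_apply]
  split_ifs
  · rfl
  · exact Nat.min_zero m

/-- A second difference of kernel dimensions counts the Jordan blocks of size exactly `m`. -/
theorem card_jordan_blocks [DecidableEq K] {ι : Type*} [Fintype ι] (b : ι → K) (e : ι → ℕ)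
    (m : ℕ) (c : K) :
    (Fintype.card {i // (b i, e i) = (c, m + 1)} : ℤ) =
      2 * kerDim (∀ i, K[X] ⧸ Ideal.span {(X - C (b i)) ^ e i}) (m + 1) c -
        kerDim (∀ i, K[X] ⧸ Ideal.span {(X - C (b i)) ^ e i}) m c -
        kerDim (∀ i, K[X] ⧸ Ideal.span {(X - C (b i)) ^ e i}) (m + 2) c := by
  simp only [kerDim_jordan, Fintype.card_subtype, Finset.card_filter, Nat.cast_sum,
    Finset.mul_sum, ← Finset.sum_sub_distrib]
  refine Finset.sum_congr rfl fun i _ => ?_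
  simp only [Prod.mk.injEq]
  by_cases h : b i = c
  · simp only [h, true_and, if_true]
    split_ifs <;> omega
  · simp [h]

/-- Finite-dimensional `K[X]`-modules are classified by their kernel dimensions. -/
theorem nonempty_linearEquiv_of_kerDim_eq [IsAlgClosed K] (M N : Type*)
    [AddCommGroup M] [Module K[X] M] [Module K M] [IsScalarTower K K[X] M] [Module.Finite K M]
    [AddCommGroup N] [Module K[X] N] [Module K N] [IsScalarTower K K[X] N] [Module.Finite K N]
    (h : ∀ (m : ℕ) (c : K), kerDim M m c = kerDim N m c) : Nonempty (M ≃ₗ[K[X]] N) := by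
  classical
  obtain ⟨ι, _, b, e, he, ⟨E⟩⟩ := exists_jordan_decomposition (K := K) M
  obtain ⟨κ, _, b', e', he', ⟨E'⟩⟩ := exists_jordan_decomposition (K := K) N
  have hcard : ∀ p : K × ℕ, Nonempty ({i // (b i, e i) = p} ≃ {j // (b' j, e' j) = p}) := by
    rintro ⟨c, m⟩
    refine Fintype.card_eq.1 ?_
    rcases m with _ | m
    · have h1 : IsEmpty {i // (b i, e i) = (c, 0)} :=
        ⟨fun i => (he i).ne' (Prod.ext_iff.1 i.2).2⟩
      have h2 : IsEmpty {i // (b' i, e' i) = (c, 0)} :=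
        ⟨fun i => (he' i).ne' (Prod.ext_iff.1 i.2).2⟩
      rw [Fintype.card_eq_zero, Fintype.card_eq_zero]
    · have h1 := card_jordan_blocks b e m c
      have h2 := card_jordan_blocks b' e' m c
      simp only [← kerDim_congr E, ← kerDim_congr E', h] at h1 h2
      exact_mod_cast h1.trans h2.symm
  let σ : ι ≃ κ := Equiv.ofFiberEquiv fun p => (hcard p).some
  have hσ : ∀ i, (b' (σ i), e' (σ i)) = (b i, e i) := fun i =>
    Equiv.ofFiberEquiv_map (fun p => (hcard p).some) i
  suffices G : (∀ i, K[X] ⧸ Ideal.span {(X - C (b i)) ^ e i}) ≃ₗ[K[X]]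
      ∀ j, K[X] ⧸ Ideal.span {(X - C (b' j)) ^ e' j} from ⟨E.trans (G.trans E'.symm)⟩
  refine (LinearEquiv.piCongrRight fun i => Submodule.quotEquivOfEq _ _ ?_).trans
    (LinearEquiv.piCongrLeft K[X] (fun j => K[X] ⧸ Ideal.span {(X - C (b' j)) ^ e' j}) σ)
  obtain ⟨hb, he⟩ := Prod.mk.inj (hσ i)
  rw [hb, he]

end Jordan

/-! ### Extensions of a common submodule by a cyclic module -/

section Extensions

variable {K : Type*} [Field K]

theorem finrank_range_le_of_ker_le_ker {V W W' : Type*} [AddCommGroup V] [Module K V]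
    [AddCommGroup W] [Module K W] [AddCommGroup W'] [Module K W'] [Module.Finite K V]
    (L : V →ₗ[K] W) (φ : V →ₗ[K] W') (h : LinearMap.ker φ ≤ LinearMap.ker L) :
    finrank K (LinearMap.range L) ≤ finrank K (LinearMap.range φ) := by
  have h1 := L.finrank_range_add_finrank_ker
  have h2 := φ.finrank_range_add_finrank_ker
  have h3 := Submodule.finrank_mono h
  omega

/-- If `F` is generated by the image of `H` and by `a`, then `H` together with the multiples of
`a` by polynomials of degree below `d = finrank F - finrank H` parametrizes `F` over `K`. -/
theorem exists_coordinates {F H : Type*} [AddCommGroup F] [Module K[X] F] [Module K F]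
    [IsScalarTower K K[X] F] [Module.Finite K F] [AddCommGroup H] [Module K[X] H] [Module K H]
    [IsScalarTower K K[X] H] [Module.Finite K H] (i : H →ₗ[K[X]] F) (hi : Function.Injective i)
    (a : F) (ha : LinearMap.range i ⊔ K[X] ∙ a = ⊤) {d : ℕ}
    (hd : finrank K F = finrank K H + d) :
    ∃ Φ : (H × degreeLT K d) ≃ₗ[K] F,
      ∀ x, Φ x = i x.1 + (x.2 : K[X]) • a := by
  let iK : H →ₗ[K] F := i.restrictScalars K
  let aK : degreeLT K d →ₗ[K] F :=
    ((LinearMap.toSpanSingleton K[X] F a).restrictScalars K).comp (degreeLT K d).subtype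
  let Φ : H × degreeLT K d →ₗ[K] F := iK.coprod aK
  have hΦ : ∀ x, Φ x = i x.1 + (x.2 : K[X]) • a := fun _ => rfl
  have hfin : Module.Finite K (degreeLT K d) :=
    Module.Finite.equiv (degreeLTEquiv K d).symm
  have hdim : finrank K (H × degreeLT K d) = finrank K F := by
    rw [finrank_prod, (degreeLTEquiv K d).finrank_eq, finrank_fin_fun]
    omega
  have hsurj : Function.Surjective Φ := by
    intro x
    -- The characteristic polynomial of `X` on the quotient by `H` has degree `d` and moves `a`
    -- into the image of `H`, so every multiple of `a` can be reduced modulo it.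
    let Q := F ⧸ LinearMap.range i
    set χ := LinearMap.charpoly (Algebra.lsmul K K Q (X : K[X]) : Module.End K Q) with hχ
    have hmonic : χ.Monic := LinearMap.charpoly_monic _
    have hdeg : χ.natDegree = d := by
      have h1 : finrank K Q + finrank K (LinearMap.range iK) = finrank K F :=
        Submodule.finrank_quotient_add_finrank (LinearMap.range iK)
      rw [LinearMap.finrank_range_of_inj (f := iK) hi] at h1
      rw [hχ, LinearMap.charpoly_natDegree]
      omega
    have hχa : χ • a ∈ LinearMap.range i := by
      rw [← Submodule.Quotient.mk_eq_zero, Submodule.Quotient.mk_smul]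
      exact charpoly_lsmul_X_smul (K := K) (Submodule.Quotient.mk a : Q)
    have hx : x ∈ LinearMap.range i ⊔ K[X] ∙ a := ha ▸ Submodule.mem_top
    obtain ⟨_, ⟨y, rfl⟩, _, hz, rfl⟩ := Submodule.mem_sup.1 hx
    obtain ⟨p, rfl⟩ := Submodule.mem_span_singleton.1 hz
    obtain ⟨w, hw⟩ := hχa
    refine ⟨(y + (p /ₘ χ) • w, ⟨p %ₘ χ, ?_⟩), ?_⟩
    · rw [mem_degreeLT]
      refine (degree_modByMonic_lt p hmonic).trans_eq ?_
      rw [degree_eq_natDegree hmonic.ne_zero, hdeg]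
    · rw [hΦ]
      simp only
      conv_rhs => rw [← modByMonic_add_div p χ]
      rw [map_add, map_smul, hw, add_smul, mul_comm, mul_smul]
      abel
  have hinj : Function.Injective Φ :=
    (LinearMap.injective_iff_surjective_of_finrank_eq_finrank hdim).2 hsurj
  exact ⟨LinearEquiv.ofBijective Φ ⟨hinj, hsurj⟩, hΦ⟩

/-- Two modules of equal dimension, each an extension of a cyclic module by the same module `H`,
can be identified so that the two multiplications by `X` differ by rank at most one: in the
coordinates `H × {p | deg p < d}` both send `(h, p)` to `(X • h, X * p)` as long as
`deg p < d - 1`. -/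
theorem exists_linearEquiv_finrank_range_le_one {F G H : Type*}
    [AddCommGroup F] [Module K[X] F] [Module K F] [IsScalarTower K K[X] F] [Module.Finite K F]
    [AddCommGroup G] [Module K[X] G] [Module K G] [IsScalarTower K K[X] G] [Module.Finite K G]
    [AddCommGroup H] [Module K[X] H] [Module K H] [IsScalarTower K K[X] H] [Module.Finite K H]
    (hFG : finrank K F = finrank K G)
    (i : H →ₗ[K[X]] F) (hi : Function.Injective i) (a : F) (ha : LinearMap.range i ⊔ K[X] ∙ a = ⊤)
    (j : H →ₗ[K[X]] G) (hj : Function.Injective j) (b : G)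
    (hb : LinearMap.range j ⊔ K[X] ∙ b = ⊤) :
    ∃ θ : F ≃ₗ[K] G, finrank K (LinearMap.range
      ((θ : F →ₗ[K] G) ∘ₗ Algebra.lsmul K K F (X : K[X]) -
        (Algebra.lsmul K K G (X : K[X]) : G →ₗ[K] G) ∘ₗ θ)) ≤ 1 := by
  have hle : finrank K H ≤ finrank K F :=
    LinearMap.finrank_le_finrank_of_injective (f := i.restrictScalars K) hi
  obtain ⟨d, hd⟩ := Nat.exists_eq_add_of_le hle
  obtain ⟨Φ, hΦ⟩ := exists_coordinates i hi a ha hd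
  obtain ⟨Ψ, hΨ⟩ := exists_coordinates j hj b hb (hFG ▸ hd)
  have hfin : Module.Finite K (degreeLT K d) := Module.Finite.equiv (degreeLTEquiv K d).symm
  refine ⟨Φ.symm.trans Ψ, ?_⟩
  set D := ((Φ.symm.trans Ψ : F ≃ₗ[K] G) : F →ₗ[K] G) ∘ₗ Algebra.lsmul K K F (X : K[X]) -
    (Algebra.lsmul K K G (X : K[X]) : G →ₗ[K] G) ∘ₗ (Φ.symm.trans Ψ : F ≃ₗ[K] G) with hD
  have hDapp : ∀ x, D (Φ x) = Ψ (Φ.symm ((X : K[X]) • Φ x)) - (X : K[X]) • Ψ x := by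
    intro x
    simp [hD]
  let φ : H × degreeLT K d →ₗ[K] K :=
    ((lcoeff K (d - 1)).comp (degreeLT K d).subtype).comp (LinearMap.snd K _ _)
  have hker : LinearMap.ker φ ≤ LinearMap.ker (D ∘ₗ (Φ : (H × degreeLT K d) →ₗ[K] F)) := by
    rintro ⟨h, p, hp⟩ hx
    have hcoeff : p.coeff (d - 1) = 0 := hx
    have hXp : X * p ∈ degreeLT K d := by
      rw [mem_degreeLT, degree_lt_iff_coeff_zero] at hp ⊢
      rintro (_ | m) hm
      · exact coeff_X_mul_zero p
      · rw [coeff_X_mul]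
        rcases Nat.lt_or_ge m d with h | h
        · rwa [show m = d - 1 by omega]
        · exact hp m h
    have h1 : (X : K[X]) • Φ (h, ⟨p, hp⟩) = Φ ((X : K[X]) • h, ⟨X * p, hXp⟩) := by
      rw [hΦ, hΦ, smul_add, map_smul, smul_smul]
    have h2 : (X : K[X]) • Ψ (h, ⟨p, hp⟩) = Ψ ((X : K[X]) • h, ⟨X * p, hXp⟩) := by
      rw [hΨ, hΨ, smul_add, map_smul, smul_smul]
    rw [LinearMap.mem_ker, LinearMap.comp_apply, LinearEquiv.coe_coe, hDapp, h1, h2,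
      Φ.symm_apply_apply, sub_self]
  have h := finrank_range_le_of_ker_le_ker _ φ hker
  rw [LinearMap.range_comp_of_range_eq_top _ Φ.range] at h
  exact h.trans ((Submodule.finrank_le _).trans_eq (finrank_self K))

/-- For `f i = q i * h i`, the map `∏ K[X] / h i → ∏ K[X] / f i` sending the `i`-th generator `y i`
to `q i • a i - a (i + 1)`, where `a i` are the generators of the target (and the term
`a (i + 1)` is absent for the last index). It is well defined when `f (i + 1) ∣ h i`. -/
noncomputable def interlacingMap {r : ℕ} (q h f : Fin (r + 1) → K[X])
    (hf : ∀ i, f i = q i * h i) (hfh : ∀ j : Fin r, f j.succ ∣ h j.castSucc) :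
    (∀ i, K[X] ⧸ Ideal.span {h i}) →ₗ[K[X]] ∀ i, K[X] ⧸ Ideal.span {f i} :=
  LinearMap.pi fun i => Fin.cases (motive := fun i =>
      (∀ i, K[X] ⧸ Ideal.span {h i}) →ₗ[K[X]] K[X] ⧸ Ideal.span {f i})
    (mulQuot (q 0) (h 0) (f 0) (hf 0).dvd ∘ₗ LinearMap.proj 0)
    (fun j => mulQuot (q j.succ) (h j.succ) (f j.succ) (hf _).dvd ∘ₗ LinearMap.proj j.succ -
      mulQuot 1 (h j.castSucc) (f j.succ) ((hfh j).trans (Dvd.intro_left 1 rfl)) ∘ₗ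
        LinearMap.proj j.castSucc) i

section

variable {r : ℕ} (q h f : Fin (r + 1) → K[X]) (hf : ∀ i, f i = q i * h i)
  (hfh : ∀ j : Fin r, f j.succ ∣ h j.castSucc)

theorem interlacingMap_zero (z : ∀ i, K[X] ⧸ Ideal.span {h i}) :
    interlacingMap q h f hf hfh z 0 = mulQuot (q 0) (h 0) (f 0) (hf 0).dvd (z 0) := rfl

theorem interlacingMap_succ (z : ∀ i, K[X] ⧸ Ideal.span {h i}) (j : Fin r) :
    interlacingMap q h f hf hfh z j.succ =
      mulQuot (q j.succ) (h j.succ) (f j.succ) (hf _).dvd (z j.succ) -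
        mulQuot 1 (h j.castSucc) (f j.succ) ((hfh j).trans (Dvd.intro_left 1 rfl))
          (z j.castSucc) := rfl

theorem interlacingMap_injective (hq : ∀ i, q i ≠ 0) :
    Function.Injective (interlacingMap q h f hf hfh) := by
  refine (injective_iff_map_eq_zero _).2 fun z hz => funext fun i => ?_
  have hinj := fun i => (injective_iff_map_eq_zero _).1 (mulQuot_injective (hq i) (hf i))
  induction i using Fin.induction with
  | zero => exact hinj 0 _ (congrFun hz 0)
  | succ j ih =>
    have h1 := congrFun hz j.succ
    rw [interlacingMap_succ, ih, Pi.zero_apply, map_zero, sub_zero] at h1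
    exact hinj _ _ h1

theorem interlacingMap_single (j : Fin r) :
    interlacingMap q h f hf hfh (Pi.single j.castSucc 1) =
      q j.castSucc • (Pi.single j.castSucc 1 : ∀ i, K[X] ⧸ Ideal.span {f i}) -
        Pi.single j.succ 1 := by
  have hmul : ∀ i, mulQuot (q i) (h i) (f i) (hf i).dvd
      ((Pi.single j.castSucc 1 : ∀ i, K[X] ⧸ Ideal.span {h i}) i) =
      q i • (Pi.single j.castSucc 1 : ∀ i, K[X] ⧸ Ideal.span {f i}) i := by
    intro i
    rcases eq_or_ne i j.castSucc with rfl | hi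
    · rw [Pi.single_eq_same, Pi.single_eq_same]
      rfl
    · rw [Pi.single_eq_of_ne hi, Pi.single_eq_of_ne hi, map_zero, smul_zero]
  have hq : ∀ i, q i • (Pi.single j.castSucc 1 : ∀ i, K[X] ⧸ Ideal.span {f i}) i =
      q j.castSucc • (Pi.single j.castSucc 1 : ∀ i, K[X] ⧸ Ideal.span {f i}) i := by
    intro i
    rcases eq_or_ne i j.castSucc with rfl | hi
    · rfl
    · rw [Pi.single_eq_of_ne hi, smul_zero, smul_zero]
  funext i
  refine Fin.cases ?_ (fun l => ?_) i
  · rw [interlacingMap_zero, hmul, hq, Pi.sub_apply, Pi.smul_apply,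
      Pi.single_eq_of_ne (Fin.succ_ne_zero j).symm, sub_zero]
  · rw [interlacingMap_succ, hmul, hq, Pi.sub_apply, Pi.smul_apply]
    congr 1
    rcases eq_or_ne l j with rfl | hl
    · rw [Pi.single_eq_same, Pi.single_eq_same]
      exact congrArg (Ideal.Quotient.mk _) (mul_one 1)
    · rw [Pi.single_eq_of_ne (by simpa using hl), Pi.single_eq_of_ne (by simpa using hl),
        map_zero]

/-- Modulo the image of `interlacingMap`, every generator `a i` is a multiple of `a 0`. -/
theorem range_interlacingMap_sup_span :
    LinearMap.range (interlacingMap q h f hf hfh) ⊔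
      K[X] ∙ (Pi.single 0 1 : ∀ i, K[X] ⧸ Ideal.span {f i}) = ⊤ := by
  set N := LinearMap.range (interlacingMap q h f hf hfh) ⊔
      K[X] ∙ (Pi.single 0 1 : ∀ i, K[X] ⧸ Ideal.span {f i}) with hN
  have hgen : ∀ i, (Pi.single i 1 : ∀ i, K[X] ⧸ Ideal.span {f i}) ∈ N := by
    intro i
    induction i using Fin.induction with
    | zero => exact Submodule.mem_sup_right (Submodule.mem_span_singleton_self _)
    | succ j ih =>
      have h1 : interlacingMap q h f hf hfh (Pi.single j.castSucc 1) ∈ N :=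
        Submodule.mem_sup_left (LinearMap.mem_range_self _ _)
      rw [interlacingMap_single] at h1
      simpa using N.sub_mem (N.smul_mem (q j.castSucc) ih) h1
  refine eq_top_iff.2 fun x _ => ?_
  rw [← Finset.univ_sum_single x]
  refine N.sum_mem fun i _ => ?_
  obtain ⟨p, hp⟩ := Ideal.Quotient.mk_surjective (x i)
  have h1 := N.smul_mem p (hgen i)
  have h2 : p • (Pi.single i 1 : ∀ i, K[X] ⧸ Ideal.span {f i}) = Pi.single i (x i) := by
    rw [← Pi.single_smul, ← hp]
    exact congrArg _ (congrArg (Ideal.Quotient.mk _) (mul_one p))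
  rwa [h2] at h1

end

end Extensions

/-! ### Weyr characteristics of modules and of matrices -/

section WeyrCharacteristic

/-- The Weyr characteristic of a finite-dimensional `ℂ[X]`-module. -/
noncomputable def moduleWeyr (M : Type*) [AddCommGroup M] [Module ℂ[X] M] [Module ℂ M]
    [IsScalarTower ℂ ℂ[X] M] (m : ℕ+) (c : ℂ) : ℕ :=
  kerDim M m c - kerDim M (m - 1) c

theorem moduleWeyr_congr {M N : Type*} [AddCommGroup M] [Module ℂ[X] M] [Module ℂ M]
    [IsScalarTower ℂ ℂ[X] M] [AddCommGroup N] [Module ℂ[X] N] [Module ℂ N]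
    [IsScalarTower ℂ ℂ[X] N] (e : M ≃ₗ[ℂ[X]] N) : moduleWeyr M = moduleWeyr N := by
  funext m c
  rw [moduleWeyr, moduleWeyr, kerDim_congr e, kerDim_congr e]

theorem kerDim_zero (M : Type*) [AddCommGroup M] [Module ℂ[X] M] [Module ℂ M]
    [IsScalarTower ℂ ℂ[X] M] (c : ℂ) : kerDim M 0 c = 0 := by
  have h : Submodule.torsionBy ℂ[X] M ((X - C c) ^ 0) = ⊥ := by
    rw [pow_zero, Submodule.torsionBy_one]
  rw [kerDim, h, finrank_zero_of_subsingleton]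

theorem kerDim_le_succ (M : Type*) [AddCommGroup M] [Module ℂ[X] M] [Module ℂ M]
    [IsScalarTower ℂ ℂ[X] M] [Module.Finite ℂ M] (m : ℕ) (c : ℂ) :
    kerDim M m c ≤ kerDim M (m + 1) c := by
  have h := Submodule.torsionBy_le_torsionBy_of_dvd (R := ℂ[X]) (M := M) _ _
    (pow_dvd_pow (X - C c) (Nat.le_add_right m 1))
  exact Submodule.finrank_mono (s := (Submodule.torsionBy ℂ[X] M _).restrictScalars ℂ)
    (t := (Submodule.torsionBy ℂ[X] M _).restrictScalars ℂ) h

theorem kerDim_eq_of_moduleWeyr_eq {M N : Type*} [AddCommGroup M] [Module ℂ[X] M] [Module ℂ M]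
    [IsScalarTower ℂ ℂ[X] M] [Module.Finite ℂ M] [AddCommGroup N] [Module ℂ[X] N] [Module ℂ N]
    [IsScalarTower ℂ ℂ[X] N] [Module.Finite ℂ N] (h : moduleWeyr M = moduleWeyr N)
    (m : ℕ) (c : ℂ) : kerDim M m c = kerDim N m c := by
  induction m with
  | zero => rw [kerDim_zero, kerDim_zero]
  | succ m ih =>
    have h1 := congrFun (congrFun h m.succPNat) c
    simp only [moduleWeyr, Nat.succPNat_coe, Nat.succ_eq_add_one, Nat.add_sub_cancel] at h1
    have h2 := kerDim_le_succ M m c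
    have h3 := kerDim_le_succ N m c
    omega

open Classical in
/-- The Weyr characteristic counts Jordan blocks: `η_m(c)` is the number of blocks with
eigenvalue `c` and size at least `m`. -/
theorem moduleWeyr_jordan {ι : Type*} [Fintype ι] (b : ι → ℂ) (e : ι → ℕ) (m : ℕ+) (c : ℂ) :
    moduleWeyr (∀ i, ℂ[X] ⧸ Ideal.span {(X - C (b i)) ^ e i}) m c =
      ∑ i, if b i = c ∧ (m : ℕ) ≤ e i then 1 else 0 := by
  rw [moduleWeyr, kerDim_jordan, kerDim_jordan]
  refine Nat.sub_eq_of_eq_add ?_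
  rw [← Finset.sum_add_distrib]
  refine Finset.sum_congr rfl fun i _ => ?_
  have hm := m.pos
  by_cases h : b i = c
  · simp only [h, true_and, if_true]
    split_ifs <;> omega
  · simp [h]

theorem isWeyrCharacteristic_moduleWeyr (M : Type*) [AddCommGroup M] [Module ℂ[X] M] [Module ℂ M]
    [IsScalarTower ℂ ℂ[X] M] [Module.Finite ℂ M] :
    IsWeyrCharacteristic (finrank ℂ M) (moduleWeyr M) := by
  classical
  obtain ⟨ι, _, b, e, he, ⟨E⟩⟩ := exists_jordan_decomposition (K := ℂ) M
  have hη : ∀ (m : ℕ+) (c : ℂ), moduleWeyr M m c =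
      ∑ i, if b i = c ∧ (m : ℕ) ≤ e i then 1 else 0 := fun m c => by
    rw [moduleWeyr_congr E, moduleWeyr_jordan]
  have hrank : finrank ℂ M = ∑ i, e i := by
    have hne : ∀ i, (X - C (b i)) ^ e i ≠ 0 := fun i => pow_ne_zero _ (X_sub_C_ne_zero _)
    have := fun i => finite_quotient_span (hne i)
    rw [(E.restrictScalars ℂ).finrank_eq, finrank_pi_fintype]
    refine Finset.sum_congr rfl fun i _ => ?_
    rw [finrank_quotient_span_eq_natDegree, natDegree_pow, natDegree_X_sub_C, mul_one]
  let u : ι → ℕ+ := fun i => ⟨e i, he i⟩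
  let B : ι → Finset (ℕ+ × ℂ) := fun i => Finset.Icc 1 (u i) ×ˢ {b i}
  have hB : ∀ i p, p ∈ B i ↔ b i = p.2 ∧ (p.1 : ℕ) ≤ e i := by
    intro i p
    simp only [B, Finset.mem_product, Finset.mem_Icc, Finset.mem_singleton, one_le, true_and]
    rw [and_comm, eq_comm]
    rfl
  have hsupp : (Function.support fun p : ℕ+ × ℂ => moduleWeyr M p.1 p.2) ⊆
      (Finset.univ.biUnion B : Finset (ℕ+ × ℂ)) := by
    intro p hp
    rw [Function.mem_support, hη] at hp
    obtain ⟨i, _, hi⟩ := Finset.exists_ne_zero_of_sum_ne_zero hp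
    refine Finset.mem_coe.2 (Finset.mem_biUnion.2 ⟨i, Finset.mem_univ i, (hB i p).2 ?_⟩)
    by_contra h
    exact hi (if_neg h)
  refine ⟨(Finset.finite_toSet _).subset hsupp, fun m c => ?_, ?_⟩
  · rw [hη, hη]
    refine Finset.sum_le_sum fun i _ => ?_
    have : ((m + 1 : ℕ+) : ℕ) = m + 1 := rfl
    split_ifs with h1 h2
    · exact le_rfl
    · exact absurd ⟨h1.1, by omega⟩ h2
    · exact Nat.zero_le _
    · exact le_rfl
  · rw [finsum_eq_sum_of_support_subset _ hsupp, hrank]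
    simp only [hη]
    rw [Finset.sum_comm]
    refine Finset.sum_congr rfl fun i _ => ?_
    simp only [← hB]
    rw [← Finset.card_filter, Finset.filter_mem_eq_inter,
      Finset.inter_eq_right.2 (Finset.subset_biUnion_of_mem B (Finset.mem_univ i))]
    rw [Finset.card_product, Finset.card_singleton, mul_one, PNat.card_Icc]
    exact Nat.add_sub_cancel (e i) 1

/-- `ℂⁿ` as a `ℂ[X]`-module, with `X` acting by `A`. -/
abbrev matrixModule {n : ℕ} (A : Matrix (Fin n) (Fin n) ℂ) : Type :=
  AEval' (Matrix.toLin' A)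

theorem finrank_matrixModule {n : ℕ} (A : Matrix (Fin n) (Fin n) ℂ) :
    finrank ℂ (matrixModule A) = n := by
  rw [← (AEval'.of (Matrix.toLin' A)).finrank_eq, finrank_fin_fun]

theorem finrank_kerPow {n : ℕ} (A : Matrix (Fin n) (Fin n) ℂ) (m : ℕ) (c : ℂ) :
    finrank ℂ (kerPow A m c) = kerDim (matrixModule A) m c := by
  let e := AEval'.of (Matrix.toLin' A)
  have h : (kerPow A m c).map (e : _ →ₗ[ℂ] matrixModule A) =
      (Submodule.torsionBy ℂ[X] (matrixModule A) ((X - C c) ^ m)).restrictScalars ℂ := by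
    have hp : aeval (Matrix.toLin' A) ((X - C c) ^ m) =
        (-1 : ℂ) ^ m • Matrix.toLin' ((c • (1 : Matrix (Fin n) (Fin n) ℂ) - A) ^ m) := by
      rw [Matrix.toLin'_pow, ← _root_.smul_pow, map_pow, map_sub, aeval_X, aeval_C, map_sub, map_smul,
        Matrix.toLin'_one, neg_one_smul, neg_sub]
      rfl
    have key : ∀ x, x ∈ kerPow A m c ↔ ((X - C c) ^ m : ℂ[X]) • e x = 0 := by
      intro x
      have h1 : ((X - C c) ^ m : ℂ[X]) • e x = e (aeval (Matrix.toLin' A) ((X - C c) ^ m) x) := rfl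
      rw [h1, hp, LinearEquiv.map_eq_zero_iff, LinearMap.smul_apply,
        smul_eq_zero_iff_right (pow_ne_zero _ (neg_ne_zero.2 one_ne_zero))]
      rfl
    ext y
    obtain ⟨x, rfl⟩ := e.surjective y
    rw [Submodule.mem_map_equiv, e.symm_apply_apply, key]
    rfl
  rw [(e.submoduleMap (kerPow A m c)).finrank_eq]
  exact (LinearEquiv.ofEq _ _ h).finrank_eq

theorem weyr_eq_moduleWeyr {n : ℕ} (A : Matrix (Fin n) (Fin n) ℂ) :
    weyr A = moduleWeyr (matrixModule A) := by
  funext m c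
  rw [weyr, moduleWeyr, finrank_kerPow, finrank_kerPow]

theorem isWeyrCharacteristic_weyr {n : ℕ} (A : Matrix (Fin n) (Fin n) ℂ) :
    IsWeyrCharacteristic n (weyr A) := by
  have h := isWeyrCharacteristic_moduleWeyr (matrixModule A)
  rwa [finrank_matrixModule, ← weyr_eq_moduleWeyr] at h

end WeyrCharacteristic

/-! ### Invariant factors with a prescribed Weyr characteristic -/

section InvariantFactors

/-- The size of the `i`-th largest (counting from `0`) Jordan block with eigenvalue `c`: the
conjugate of the partition `m ↦ η m c`. -/
noncomputable def blockSize (η : ℕ+ → ℂ → ℕ) (i : ℕ) (c : ℂ) : ℕ :=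
  Set.ncard {m : ℕ+ | i < η m c}

namespace IsWeyrCharacteristic

variable {n : ℕ} {η : ℕ+ → ℂ → ℕ}

theorem finite_setOf_lt (hη : IsWeyrCharacteristic n η) (i : ℕ) (c : ℂ) :
    {m : ℕ+ | i < η m c}.Finite :=
  (hη.finite_support.preimage (f := fun m : ℕ+ => (m, c))
    (fun _ _ _ _ h => (Prod.mk.inj h).1)).subset fun _ hm => (Nat.zero_le i |>.trans_lt hm).ne'

theorem le_of_le (hη : IsWeyrCharacteristic n η) (c : ℂ) {l m : ℕ+} (h : l ≤ m) :
    η m c ≤ η l c := by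
  induction m using PNat.recOn with
  | one => rw [le_antisymm h one_le]
  | succ m ih =>
    rcases h.lt_or_eq with h | rfl
    · exact (hη.antitone m c).trans (ih (PNat.lt_add_one_iff.1 h))
    · exact le_rfl

theorem le_blockSize_iff (hη : IsWeyrCharacteristic n η) (i : ℕ) (m : ℕ+) (c : ℂ) :
    (m : ℕ) ≤ blockSize η i c ↔ i < η m c := by
  constructor
  · intro h
    by_contra hi
    have hsub : {l : ℕ+ | i < η l c} ⊆ (Finset.Ico 1 m : Finset ℕ+) := by
      intro l hl
      refine Finset.mem_coe.2 (Finset.mem_Ico.2 ⟨one_le, ?_⟩)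
      by_contra hlm
      exact hi (lt_of_lt_of_le hl (hη.le_of_le c (not_lt.1 hlm)))
    have h1 := Set.ncard_le_ncard hsub
    rw [Set.ncard_coe_finset, PNat.card_Ico, PNat.one_coe] at h1
    have := m.pos
    unfold blockSize at h
    omega
  · intro h
    have hsub : ((Finset.Icc 1 m : Finset ℕ+) : Set ℕ+) ⊆ {l : ℕ+ | i < η l c} := fun l hl =>
      lt_of_lt_of_le h (hη.le_of_le c (Finset.mem_Icc.1 (Finset.mem_coe.1 hl)).2)
    have h1 := Set.ncard_le_ncard hsub (hη.finite_setOf_lt i c)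
    rwa [Set.ncard_coe_finset, PNat.card_Icc, PNat.one_coe, Nat.add_sub_cancel] at h1

theorem blockSize_le (hη : IsWeyrCharacteristic n η) {η' : ℕ+ → ℂ → ℕ} {i j : ℕ} {c : ℂ}
    (h : ∀ m, i < η' m c → j < η m c) : blockSize η' i c ≤ blockSize η j c :=
  Set.ncard_le_ncard h (hη.finite_setOf_lt j c)

/-- The eigenvalues occurring in a Weyr characteristic. -/
noncomputable def eigenvalues (hη : IsWeyrCharacteristic n η) : Finset ℂ :=
  hη.finite_support.toFinset.image Prod.snd

theorem eq_zero_of_notMem (hη : IsWeyrCharacteristic n η) {c : ℂ} (hc : c ∉ hη.eigenvalues)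
    (m : ℕ+) : η m c = 0 := by
  by_contra h
  exact hc (Finset.mem_image.2 ⟨(m, c), hη.finite_support.mem_toFinset.2 h, rfl⟩)

theorem exists_le (hη : IsWeyrCharacteristic n η) : ∃ r, ∀ m c, η m c ≤ r := by
  refine ⟨hη.finite_support.toFinset.sup fun p => η p.1 p.2, fun m c => ?_⟩
  by_cases h : η m c = 0
  · rw [h]
    exact Nat.zero_le _
  · exact Finset.le_sup (f := fun p : ℕ+ × ℂ => η p.1 p.2)
      (hη.finite_support.mem_toFinset.2 (show η (m, c).1 (m, c).2 ≠ 0 from h))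

end IsWeyrCharacteristic

/-- The polynomial with root `c` of multiplicity `a c` for `c ∈ S`. -/
noncomputable def rootPoly (S : Finset ℂ) (a : ℂ → ℕ) : ℂ[X] :=
  ∏ c ∈ S, (X - C c) ^ a c

theorem rootPoly_ne_zero (S : Finset ℂ) (a : ℂ → ℕ) : rootPoly S a ≠ 0 :=
  Finset.prod_ne_zero_iff.2 fun c _ => pow_ne_zero _ (X_sub_C_ne_zero c)

theorem rootPoly_dvd (S : Finset ℂ) {a b : ℂ → ℕ} (h : ∀ c, a c ≤ b c) :
    rootPoly S a ∣ rootPoly S b :=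
  Finset.prod_dvd_prod_of_dvd _ _ fun c _ => pow_dvd_pow _ (h c)

theorem rootPoly_sub_mul (S : Finset ℂ) {a b : ℂ → ℕ} (h : ∀ c, a c ≤ b c) :
    rootPoly S b = rootPoly S (fun c => b c - a c) * rootPoly S a := by
  rw [rootPoly, rootPoly, rootPoly, ← Finset.prod_mul_distrib]
  refine Finset.prod_congr rfl fun c _ => ?_
  rw [← pow_add, Nat.sub_add_cancel (h c)]

theorem rootMultiplicity_rootPoly (S : Finset ℂ) (a : ℂ → ℕ) (c : ℂ) (hc : c ∉ S → a c = 0) :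
    (rootPoly S a).rootMultiplicity c = a c := by
  classical
  rw [rootPoly, ← count_roots, roots_prod _ _ (rootPoly_ne_zero S a), Multiset.count_bind]
  simp only [count_roots, rootMultiplicity_X_sub_C_pow_apply]
  change ∑ b ∈ S, _ = _
  rw [Finset.sum_ite_eq' S c a]
  split_ifs with h
  · rfl
  · exact (hc h).symm

/-- The module with invariant factors `∏ c, (X - c) ^ blockSize η i c`, `i = 0, …, r`, has Weyr
characteristic `η`. -/
theorem moduleWeyr_invariantFactors {n r : ℕ} {η : ℕ+ → ℂ → ℕ} (hη : IsWeyrCharacteristic n η)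
    (hr : ∀ m c, η m c ≤ r) {S : Finset ℂ} (hS : hη.eigenvalues ⊆ S) :
    moduleWeyr (∀ i : Fin (r + 1), ℂ[X] ⧸ Ideal.span {rootPoly S (blockSize η i)}) = η := by
  classical
  funext m c
  have := fun i : Fin (r + 1) => finite_quotient_span (rootPoly_ne_zero S (blockSize η i))
  have hmult : ∀ i, (rootPoly S (blockSize η i)).rootMultiplicity c = blockSize η i c := by
    refine fun i => rootMultiplicity_rootPoly S _ c fun hc => ?_
    by_contra h
    have h1 := (hη.le_blockSize_iff i 1 c).1 (Nat.pos_of_ne_zero h)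
    rw [hη.eq_zero_of_notMem (fun h => hc (hS h))] at h1
    exact Nat.not_lt_zero _ h1
  have hker : ∀ l, kerDim (∀ i : Fin (r + 1), ℂ[X] ⧸ Ideal.span {rootPoly S (blockSize η i)}) l c =
      ∑ i : Fin (r + 1), min l (blockSize η i c) := by
    intro l
    rw [kerDim_pi]
    refine Finset.sum_congr rfl fun i _ => ?_
    rw [kerDim_quotient_span (rootPoly_ne_zero S _), hmult]
  rw [moduleWeyr, hker, hker]
  refine Nat.sub_eq_of_eq_add ?_
  have hcount : η m c = ∑ i : Fin (r + 1), if (m : ℕ) ≤ blockSize η i c then 1 else 0 := by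
    simp only [hη.le_blockSize_iff]
    rw [Fin.sum_univ_eq_sum_range (fun i => if i < η m c then 1 else 0), ← Finset.card_filter]
    have h : (Finset.range (r + 1)).filter (fun i => i < η m c) = Finset.range (η m c) := by
      ext i
      have := hr m c
      simp only [Finset.mem_filter, Finset.mem_range]
      omega
    rw [h, Finset.card_range]
  rw [hcount, ← Finset.sum_add_distrib]
  refine Finset.sum_congr rfl fun i _ => ?_
  have hm := m.pos
  split_ifs <;> omega

/-- The dimension is read off from the sum of the Weyr characteristic. -/
theorem finrank_invariantFactors {n r : ℕ} {η : ℕ+ → ℂ → ℕ} (hη : IsWeyrCharacteristic n η)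
    (hr : ∀ m c, η m c ≤ r) {S : Finset ℂ} (hS : hη.eigenvalues ⊆ S) :
    finrank ℂ (∀ i : Fin (r + 1), ℂ[X] ⧸ Ideal.span {rootPoly S (blockSize η i)}) = n := by
  have := fun i : Fin (r + 1) => finite_quotient_span (rootPoly_ne_zero S (blockSize η i))
  have h := (isWeyrCharacteristic_moduleWeyr
    (∀ i : Fin (r + 1), ℂ[X] ⧸ Ideal.span {rootPoly S (blockSize η i)})).sum_eq
  rw [moduleWeyr_invariantFactors hη hr hS, hη.sum_eq] at h
  exact h.symm

end InvariantFactors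

/-! ### Perturbations of rank one -/

section RankOne

/-- If the module of `A` can be identified linearly with a module `G` so that the two
multiplications by `X` differ by rank at most one, then a perturbation of `A` of rank at most one
has the Weyr characteristic of `G`. -/
theorem exists_rank_le_one_of_linearEquiv {n : ℕ} (A : Matrix (Fin n) (Fin n) ℂ)
    {F G : Type*} [AddCommGroup F] [Module ℂ[X] F] [Module ℂ F] [IsScalarTower ℂ ℂ[X] F]
    [AddCommGroup G] [Module ℂ[X] G] [Module ℂ G] [IsScalarTower ℂ ℂ[X] G]
    (E : matrixModule A ≃ₗ[ℂ[X]] F) (θ : F ≃ₗ[ℂ] G)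
    (hθ : finrank ℂ (LinearMap.range
      ((θ : F →ₗ[ℂ] G) ∘ₗ Algebra.lsmul ℂ ℂ F (X : ℂ[X]) -
        (Algebra.lsmul ℂ ℂ G (X : ℂ[X]) : G →ₗ[ℂ] G) ∘ₗ θ)) ≤ 1) :
    ∃ R : Matrix (Fin n) (Fin n) ℂ, R.rank ≤ 1 ∧ weyr (A + R) = moduleWeyr G := by
  let φ : (Fin n → ℂ) ≃ₗ[ℂ] F := (AEval'.of (Matrix.toLin' A)).trans (E.restrictScalars ℂ)
  have hφ : ∀ x, φ (Matrix.toLin' A x) = (X : ℂ[X]) • φ x := fun x => by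
    change E (AEval'.of _ (Matrix.toLin' A x)) = (X : ℂ[X]) • E (AEval'.of _ x)
    rw [← AEval'.X_smul_of, map_smul]
  let ψ : (Fin n → ℂ) ≃ₗ[ℂ] G := φ.trans θ
  let T : (Fin n → ℂ) →ₗ[ℂ] (Fin n → ℂ) :=
    (ψ.symm : G →ₗ[ℂ] _) ∘ₗ (Algebra.lsmul ℂ ℂ G (X : ℂ[X]) : G →ₗ[ℂ] G) ∘ₗ ψ
  have hT : ∀ x, ψ (T x) = (X : ℂ[X]) • ψ x := fun x => ψ.apply_symm_apply _
  set D := (θ : F →ₗ[ℂ] G) ∘ₗ Algebra.lsmul ℂ ℂ F (X : ℂ[X]) -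
        (Algebra.lsmul ℂ ℂ G (X : ℂ[X]) : G →ₗ[ℂ] G) ∘ₗ θ with hD
  refine ⟨LinearMap.toMatrix' (T - Matrix.toLin' A), ?_, ?_⟩
  · have h1 : T - Matrix.toLin' A = -((ψ.symm : G →ₗ[ℂ] _) ∘ₗ D ∘ₗ (φ : _ →ₗ[ℂ] F)) := by
      refine LinearMap.ext fun x => ψ.injective ?_
      have h2 : D (φ x) = θ ((X : ℂ[X]) • φ x) - (X : ℂ[X]) • ψ x := rfl
      simp only [LinearMap.sub_apply, LinearMap.neg_apply, LinearMap.comp_apply,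
        LinearEquiv.coe_coe, map_sub, map_neg, LinearEquiv.apply_symm_apply, hT, h2, ← hφ]
      exact (neg_sub _ _).symm
    rw [Matrix.rank, ← Matrix.toLin'_apply', Matrix.toLin'_toMatrix', h1, LinearMap.range_neg,
      LinearMap.range_comp, LinearMap.range_comp_of_range_eq_top _ φ.range]
    have : Module.Finite ℂ F := Module.Finite.equiv φ
    exact (Submodule.finrank_map_le _ _).trans hθ
  · have hAT : A + LinearMap.toMatrix' (T - Matrix.toLin' A) = LinearMap.toMatrix' T := by
      rw [map_sub, LinearMap.toMatrix'_toLin', add_sub_cancel]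
    rw [hAT, weyr_eq_moduleWeyr]
    have e : matrixModule (LinearMap.toMatrix' T) ≃ₗ[ℂ[X]] G :=
      LinearEquiv.ofAEval _ ψ fun x => by
        rw [Matrix.toLin'_toMatrix']
        exact hT x
    exact moduleWeyr_congr e

/-- A Weyr characteristic at distance at most one from that of `A` is reached by a perturbation of
rank at most one. The two modules are built from invariant factors `f i`, `g i`; they
contain `∏ ℂ[X] / gcd (f i) (g i)` with cyclic quotient, because each of `f (i + 1)`, `g (i + 1)`
divides both `f i` and `g i`. -/
theorem exists_rank_le_one {n : ℕ} (A : Matrix (Fin n) (Fin n) ℂ) {η : ℕ+ → ℂ → ℕ}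
    (hη : IsWeyrCharacteristic n η) (h1 : ∀ m c, weyr A m c ≤ η m c + 1)
    (h2 : ∀ m c, η m c ≤ weyr A m c + 1) :
    ∃ R : Matrix (Fin n) (Fin n) ℂ, R.rank ≤ 1 ∧ weyr (A + R) = η := by
  classical
  have hα := isWeyrCharacteristic_weyr A
  set α := weyr A
  obtain ⟨r, hr⟩ := hη.exists_le
  have hrη : ∀ m c, η m c ≤ r + 1 := fun m c => (hr m c).trans (Nat.le_succ r)
  have hrα : ∀ m c, α m c ≤ r + 1 := fun m c => (h1 m c).trans (Nat.succ_le_succ (hr m c))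
  let S := hα.eigenvalues ∪ hη.eigenvalues
  have hSα : hα.eigenvalues ⊆ S := Finset.subset_union_left
  have hSη : hη.eigenvalues ⊆ S := Finset.subset_union_right
  let f : Fin (r + 2) → ℂ[X] := fun i => rootPoly S (blockSize α i)
  let g : Fin (r + 2) → ℂ[X] := fun i => rootPoly S (blockSize η i)
  let a : ℕ → ℂ → ℕ := fun i c => min (blockSize α i c) (blockSize η i c)
  let h : Fin (r + 2) → ℂ[X] := fun i => rootPoly S (a i)
  have hf0 : ∀ i, f i ≠ 0 := fun i => rootPoly_ne_zero S _
  have hg0 : ∀ i, g i ≠ 0 := fun i => rootPoly_ne_zero S _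
  have hh0 : ∀ i, h i ≠ 0 := fun i => rootPoly_ne_zero S _
  have := fun i => finite_quotient_span (hf0 i)
  have := fun i => finite_quotient_span (hg0 i)
  have := fun i => finite_quotient_span (hh0 i)
  have hf : ∀ i, f i = rootPoly S (fun c => blockSize α i c - a i c) * h i := fun i =>
    rootPoly_sub_mul S fun c => min_le_left _ _
  have hg : ∀ i, g i = rootPoly S (fun c => blockSize η i c - a i c) * h i := fun i =>
    rootPoly_sub_mul S fun c => min_le_right _ _
  have hfh : ∀ j : Fin (r + 1), f j.succ ∣ h j.castSucc := fun j => by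
    refine rootPoly_dvd S fun c => le_min (hα.blockSize_le fun m hm => ?_)
      (hη.blockSize_le fun m hm => ?_)
    · exact lt_of_le_of_lt (Nat.le_succ _) hm
    · exact Nat.lt_of_succ_lt_succ (lt_of_lt_of_le hm (h1 m c))
  have hgh : ∀ j : Fin (r + 1), g j.succ ∣ h j.castSucc := fun j => by
    refine rootPoly_dvd S fun c => le_min (hα.blockSize_le fun m hm => ?_)
      (hη.blockSize_le fun m hm => ?_)
    · exact Nat.lt_of_succ_lt_succ (lt_of_lt_of_le hm (h2 m c))
    · exact lt_of_le_of_lt (Nat.le_succ _) hm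
  obtain ⟨θ, hθ⟩ := exists_linearEquiv_finrank_range_le_one (K := ℂ)
    ((finrank_invariantFactors hα hrα hSα).trans (finrank_invariantFactors hη hrη hSη).symm)
    (interlacingMap _ h f hf hfh) (interlacingMap_injective _ h f hf hfh
      fun i => rootPoly_ne_zero S _) _ (range_interlacingMap_sup_span _ h f hf hfh)
    (interlacingMap _ h g hg hgh) (interlacingMap_injective _ h g hg hgh
      fun i => rootPoly_ne_zero S _) _ (range_interlacingMap_sup_span _ h g hg hgh)
  have hAf : moduleWeyr (matrixModule A) = moduleWeyr (∀ i, ℂ[X] ⧸ Ideal.span {f i}) :=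
    (weyr_eq_moduleWeyr A).symm.trans (moduleWeyr_invariantFactors hα hrα hSα).symm
  obtain ⟨E⟩ := nonempty_linearEquiv_of_kerDim_eq (K := ℂ) _ _ (kerDim_eq_of_moduleWeyr_eq hAf)
  obtain ⟨R, hR, hRG⟩ := exists_rank_le_one_of_linearEquiv A E θ hθ
  exact ⟨R, hR, hRG.trans (moduleWeyr_invariantFactors hη hrη hSη)⟩

end RankOne

/-! ### Interpolation of Weyr characteristics -/

section Interpolation

/-- A family that is nonincreasing in `m` can be raised, one unit at a time and below a given
nonincreasing bound `U`, to any sum up to that of `U`. -/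
theorem exists_antitone_sum_eq (T : Finset (ℕ+ × ℂ)) (U : ℕ+ → ℂ → ℕ)
    (hU : ∀ m c, U (m + 1) c ≤ U m c) (N : ℕ) (hN : N ≤ ∑ p ∈ T, U p.1 p.2) (L : ℕ+ → ℂ → ℕ)
    (hL : ∀ m c, L (m + 1) c ≤ L m c) (hLU : ∀ m c, L m c ≤ U m c)
    (hLN : ∑ p ∈ T, L p.1 p.2 ≤ N) (hT : ∀ m c, U m c ≠ 0 → (m, c) ∈ T) :
    ∃ γ : ℕ+ → ℂ → ℕ, (∀ m c, γ (m + 1) c ≤ γ m c) ∧ (∀ m c, L m c ≤ γ m c) ∧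
      (∀ m c, γ m c ≤ U m c) ∧ ∑ p ∈ T, γ p.1 p.2 = N := by
  classical
  obtain ⟨d, hd⟩ := Nat.exists_eq_add_of_le hLN
  induction d generalizing L with
  | zero => exact ⟨L, hL, fun _ _ => le_rfl, hLU, hd.symm⟩
  | succ d ih =>
    obtain ⟨p, -, hp⟩ := Finset.exists_lt_of_sum_lt
      (show ∑ p ∈ T, L p.1 p.2 < ∑ p ∈ T, U p.1 p.2 by omega)
    obtain ⟨l, c⟩ := p
    -- At the least `m` with `L m c < U m c`, raising `L m c` keeps the family nonincreasing.
    have hex : ∃ m : ℕ+, L m c < U m c := ⟨l, hp⟩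
    let m := PNat.find hex
    have hm : L m c < U m c := PNat.find_spec hex
    have hmin : ∀ k, k < m → U k c ≤ L k c := fun k hk => not_lt.1 (PNat.find_min hex hk)
    let L' : ℕ+ → ℂ → ℕ := fun k b => L k b + if (k, b) = (m, c) then 1 else 0
    have hmem : (m, c) ∈ T := hT m c (by omega)
    have hsum : ∑ p ∈ T, L' p.1 p.2 = ∑ p ∈ T, L p.1 p.2 + 1 := by
      simp only [L', Finset.sum_add_distrib, Prod.mk.eta, Finset.sum_ite_eq', hmem, if_true]
    have hL'U : ∀ k b, L' k b ≤ U k b := by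
      intro k b
      simp only [L']
      split_ifs with h
      · obtain ⟨rfl, rfl⟩ := Prod.mk.inj h
        exact hm
      · exact hLU k b
    have hL' : ∀ k b, L' (k + 1) b ≤ L' k b := by
      intro k b
      by_cases h : (k + 1, b) = (m, c)
      · obtain ⟨h1, rfl⟩ := Prod.mk.inj h
        calc L' (k + 1) b ≤ U (k + 1) b := hL'U _ _
          _ ≤ U k b := hU k b
          _ ≤ L k b := hmin k (h1 ▸ PNat.lt_add_right k 1)
          _ ≤ L' k b := Nat.le_add_right _ _
      · simp only [L', if_neg h]
        exact (hL k b).trans (Nat.le_add_right _ _)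
    obtain ⟨γ, h1, h2, h3, h4⟩ := ih L' hL' hL'U (by omega) (by omega)
    exact ⟨γ, h1, fun k b => (Nat.le_add_right _ _).trans (h2 k b), h3, h4⟩

/-- Weyr characteristics of equal sum at distance `k + 1` have one at distance `1` from the
first and `k` from the second. The bounds `L` and `U` on it enclose the weighted average
`(k * α + β) / (k + 1)`, whose sum is `n`. -/
theorem exists_intermediate {n k : ℕ} {α β : ℕ+ → ℂ → ℕ} (hα : IsWeyrCharacteristic n α)
    (hβ : IsWeyrCharacteristic n β) (h1 : ∀ m c, α m c ≤ β m c + (k + 1))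
    (h2 : ∀ m c, β m c ≤ α m c + (k + 1)) :
    ∃ γ, IsWeyrCharacteristic n γ ∧ (∀ m c, α m c ≤ γ m c + 1) ∧ (∀ m c, γ m c ≤ α m c + 1) ∧
      (∀ m c, γ m c ≤ β m c + k) ∧ ∀ m c, β m c ≤ γ m c + k := by
  classical
  let L : ℕ+ → ℂ → ℕ := fun m c => max (α m c - 1) (β m c - k)
  let U : ℕ+ → ℂ → ℕ := fun m c => min (min (α m c + 1) (β m c + k)) (max (α m c) (β m c))
  let T : Finset (ℕ+ × ℂ) := hα.finite_support.toFinset ∪ hβ.finite_support.toFinset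
  have hT : ∀ p : ℕ+ × ℂ, p ∉ T → α p.1 p.2 = 0 ∧ β p.1 p.2 = 0 := by
    intro p hp
    simpa [T] using hp
  have sum_eq : ∀ η : ℕ+ → ℂ → ℕ, (∀ p : ℕ+ × ℂ, p ∉ T → η p.1 p.2 = 0) →
      ∑ᶠ p : ℕ+ × ℂ, η p.1 p.2 = ∑ p ∈ T, η p.1 p.2 := fun η hη =>
    finsum_eq_sum_of_support_subset _ fun p hp => by
      by_contra h
      exact hp (hη p h)
  have hsα : ∑ p ∈ T, α p.1 p.2 = n := (sum_eq α fun p hp => (hT p hp).1).symm.trans hα.sum_eq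
  have hsβ : ∑ p ∈ T, β p.1 p.2 = n := (sum_eq β fun p hp => (hT p hp).2).symm.trans hβ.sum_eq
  have havg : ∑ p ∈ T, (k * α p.1 p.2 + β p.1 p.2) = (k + 1) * n := by
    rw [Finset.sum_add_distrib, ← Finset.mul_sum, hsα, hsβ]
    ring
  have hLavg : ∀ m c, (k + 1) * L m c ≤ k * α m c + β m c := by
    intro m c
    have h1 := h1 m c
    have h2 := h2 m c
    rcases le_total (α m c - 1) (β m c - k) with h | h
    · rw [show L m c = β m c - k from max_eq_right h]
      rcases Nat.lt_or_ge (β m c) k with h3 | h3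
      · rw [Nat.sub_eq_zero_of_le h3.le]
        omega
      · obtain ⟨b, hb⟩ := Nat.exists_eq_add_of_le h3
        rw [hb, Nat.add_sub_cancel_left]
        have : k * b ≤ k * (α m c + 1) := Nat.mul_le_mul_left k (by omega)
        linarith
    · rw [show L m c = α m c - 1 from max_eq_left h]
      rcases Nat.eq_zero_or_pos (α m c) with h3 | h3
      · rw [h3]
        omega
      · obtain ⟨a, ha⟩ := Nat.exists_eq_add_of_le h3
        rw [ha, Nat.add_sub_cancel_left]
        linarith
  have hUavg : ∀ m c, k * α m c + β m c ≤ (k + 1) * U m c := by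
    intro m c
    have h1 := h1 m c
    have h2 := h2 m c
    rcases min_choice (min (α m c + 1) (β m c + k)) (max (α m c) (β m c)) with h | h
    · rcases min_choice (α m c + 1) (β m c + k) with h' | h'
      · rw [show U m c = α m c + 1 from h.trans h']
        linarith
      · rw [show U m c = β m c + k from h.trans h']
        have : k * α m c ≤ k * (β m c + (k + 1)) := Nat.mul_le_mul_left k h1
        linarith
    · rw [show U m c = max (α m c) (β m c) from h]
      have h3 : k * α m c ≤ k * max (α m c) (β m c) := Nat.mul_le_mul_left k (le_max_left _ _)
      have h4 : β m c ≤ max (α m c) (β m c) := le_max_right _ _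
      linarith
  have hLsum : ∑ p ∈ T, L p.1 p.2 ≤ n := by
    refine Nat.le_of_mul_le_mul_left (c := k + 1) ?_ (Nat.succ_pos k)
    rw [Finset.mul_sum, ← havg]
    exact Finset.sum_le_sum fun p _ => hLavg p.1 p.2
  have hUsum : n ≤ ∑ p ∈ T, U p.1 p.2 := by
    refine Nat.le_of_mul_le_mul_left (c := k + 1) ?_ (Nat.succ_pos k)
    rw [Finset.mul_sum, ← havg]
    exact Finset.sum_le_sum fun p _ => hUavg p.1 p.2
  have hUT : ∀ m c, U m c ≠ 0 → (m, c) ∈ T := by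
    intro m c h
    by_contra hp
    have h3 := hT _ hp
    simp only at h3
    simp only [U] at h
    omega
  obtain ⟨γ, hγ, hLγ, hγU, hsum⟩ := exists_antitone_sum_eq T U
    (fun m c => by have := hα.antitone m c; have := hβ.antitone m c; simp only [U]; omega)
    n hUsum L
    (fun m c => by have := hα.antitone m c; have := hβ.antitone m c; simp only [L]; omega)
    (fun m c => by have := h1 m c; have := h2 m c; simp only [L, U]; omega) hLsum hUT
  have hγT : ∀ p : ℕ+ × ℂ, p ∉ T → γ p.1 p.2 = 0 := by
    intro p hp
    by_contra h
    have := hγU p.1 p.2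
    exact hp (hUT p.1 p.2 (by omega))
  refine ⟨γ, ⟨T.finite_toSet.subset fun p hp => ?_, hγ, (sum_eq γ hγT).trans hsum⟩, ?_⟩
  · by_contra h
    exact hp (hγT p h)
  · refine ⟨fun m c => ?_, fun m c => ?_, fun m c => ?_, fun m c => ?_⟩ <;>
    · have h3 := hLγ m c
      have h4 := hγU m c
      simp only [L, U] at h3 h4
      omega

end Interpolation

/-! ### Low-rank perturbations move the Weyr characteristic little -/

section Necessity

variable {K V W : Type*} [Field K] [AddCommGroup V] [Module K V] [Module.Finite K V]
  [AddCommGroup W] [Module K W]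

theorem finrank_map_add_finrank_inf_ker (f : V →ₗ[K] W) (S : Submodule K V) :
    finrank K (S.map f) + finrank K (S ⊓ LinearMap.ker f : Submodule K V) = finrank K S := by
  have h := (f.domRestrict S).finrank_range_add_finrank_ker
  rw [LinearMap.range_domRestrict, LinearMap.ker_domRestrict] at h
  rw [← h, ← Submodule.map_comap_subtype, Submodule.finrank_map_subtype_eq]

/-- The increments of the kernel dimensions of `N` exceed those of `M = N - R` by at most
`rank R`. Let `P = ker N ^ (m + 1)` and `W ≤ P` the subspace on
which all `R * N ^ i`, `i ≤ m`, vanish. Then `M ^ i = N ^ i` on `W` for `i ≤ m + 1`. The map `N`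
acts on `P / W`, and `R` is injective on the kernel of that action, so this kernel, hence also the
cokernel, has dimension at most `rank R`; the cokernel surjects onto `P / (W + ker N ^ m)`. -/
theorem finrank_ker_pow_succ_le (N R : Module.End K V) (m : ℕ) :
    finrank K (LinearMap.ker (N ^ (m + 1))) + finrank K (LinearMap.ker ((N - R) ^ m)) ≤
      finrank K (LinearMap.ker (N ^ m)) + finrank K (LinearMap.ker ((N - R) ^ (m + 1))) +
        finrank K (LinearMap.range R) := by
  set P := LinearMap.ker (N ^ (m + 1)) with hP
  let W : Submodule K V := P ⊓ ⨅ i : Fin (m + 1), LinearMap.ker (R * N ^ (i : ℕ))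
  have hW : ∀ x, x ∈ W ↔ (N ^ (m + 1)) x = 0 ∧ ∀ i ≤ m, R ((N ^ i) x) = 0 := by
    intro x
    simp only [W, hP, Submodule.mem_inf, Submodule.mem_iInf, LinearMap.mem_ker, Module.End.mul_apply]
    exact and_congr_right fun _ => ⟨fun h i hi => h ⟨i, Nat.lt_succ_of_le hi⟩,
      fun h i => h i (Nat.le_of_lt_succ i.2)⟩
  have hpow : ∀ x ∈ W, ∀ i ≤ m + 1, ((N - R) ^ i) x = (N ^ i) x := by
    intro x hx i
    induction i with
    | zero => exact fun _ => rfl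
    | succ i ih =>
      intro hi
      rw [pow_succ', Module.End.mul_apply, ih (by omega), pow_succ', Module.End.mul_apply,
        LinearMap.sub_apply, ((hW x).1 hx).2 i (by omega), sub_zero]
  let Z : Submodule K V := P ⊓ W.comap N
  have hWZ : finrank K Z ≤ finrank K W + finrank K (LinearMap.range R) := by
    have h1 := finrank_map_add_finrank_inf_ker R Z
    have h2 : Z ⊓ LinearMap.ker R ≤ W := by
      rintro x ⟨⟨hx, hNx⟩, hRx⟩
      refine (hW x).2 ⟨hx, fun i hi => ?_⟩
      rcases i with _ | i
      · exact hRx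
      · rw [pow_succ, Module.End.mul_apply]
        exact ((hW _).1 hNx).2 i (by omega)
    have h3 := Submodule.finrank_mono h2
    have h4 := Submodule.finrank_mono (LinearMap.map_le_range (f := R) (p := Z))
    omega
  have hcoker : finrank K P + finrank K W = finrank K (W ⊔ P.map N : Submodule K V) +
      finrank K Z := by
    have hNP : LinearMap.ker N ≤ P := fun x hx => by
      rw [hP, LinearMap.mem_ker, pow_succ, Module.End.mul_apply, LinearMap.mem_ker.1 hx, map_zero]
    have hNZ : LinearMap.ker N ≤ Z := le_inf hNP fun x hx => by
      rw [Submodule.mem_comap, LinearMap.mem_ker.1 hx]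
      exact W.zero_mem
    have hmap : Z.map N = W ⊓ P.map N := by
      ext y
      constructor
      · rintro ⟨x, ⟨hx, hNx⟩, rfl⟩
        exact ⟨hNx, x, hx, rfl⟩
      · rintro ⟨hy, x, hx, rfl⟩
        exact ⟨x, ⟨hx, hy⟩, rfl⟩
    have h1 := finrank_map_add_finrank_inf_ker N P
    have h2 := finrank_map_add_finrank_inf_ker N Z
    rw [inf_eq_right.2 hNP] at h1
    rw [inf_eq_right.2 hNZ, hmap] at h2
    have h3 := Submodule.finrank_sup_add_finrank_inf_eq W (P.map N)
    omega
  have hle : W ⊔ P.map N ≤ W ⊔ LinearMap.ker (N ^ m) := by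
    refine sup_le_sup_left ?_ W
    rintro _ ⟨x, hx, rfl⟩
    rw [LinearMap.mem_ker, ← Module.End.mul_apply, ← pow_succ]
    exact hx
  have hinf : W ⊓ LinearMap.ker (N ^ m) = W ⊓ LinearMap.ker ((N - R) ^ m) := by
    ext x
    refine and_congr_right fun hx => ?_
    change (N ^ m) x = 0 ↔ ((N - R) ^ m) x = 0
    rw [hpow x hx m (Nat.le_succ m)]
  have hsup : W ⊔ LinearMap.ker ((N - R) ^ m) ≤ LinearMap.ker ((N - R) ^ (m + 1)) := by
    refine sup_le (fun x hx => ?_) fun x hx => ?_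
    · rw [LinearMap.mem_ker, hpow x hx _ le_rfl]
      exact ((hW x).1 hx).1
    · rw [LinearMap.mem_ker, pow_succ', Module.End.mul_apply, LinearMap.mem_ker.1 hx, map_zero]
  have h1 := Submodule.finrank_mono hle
  have h2 := Submodule.finrank_mono hsup
  have h3 := Submodule.finrank_sup_add_finrank_inf_eq W (LinearMap.ker (N ^ m))
  have h4 := Submodule.finrank_sup_add_finrank_inf_eq W (LinearMap.ker ((N - R) ^ m))
  rw [hinf] at h3
  omega

theorem weyr_le_weyr_add_rank {n : ℕ} (A R : Matrix (Fin n) (Fin n) ℂ) (m : ℕ+) (c : ℂ) :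
    weyr A m c ≤ weyr (A + R) m c + R.rank := by
  have hker : ∀ (B : Matrix (Fin n) (Fin n) ℂ) (l : ℕ), kerPow B l c =
      LinearMap.ker (Matrix.toLin' (c • (1 : Matrix (Fin n) (Fin n) ℂ) - B) ^ l) := fun B l => by
    rw [kerPow, Matrix.toLin'_pow]
  have h := finrank_ker_pow_succ_le (Matrix.toLin' (c • (1 : Matrix (Fin n) (Fin n) ℂ) - A))
    (Matrix.toLin' R) ((m : ℕ) - 1)
  rw [← map_sub, sub_sub, Nat.sub_add_cancel m.pos, ← hker, ← hker, ← hker, ← hker,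
    Matrix.toLin'_apply'] at h
  have h1 := weyr_cast A m c
  have h2 := weyr_cast (A + R) m c
  change _ ≤ _ + R.rank at h
  omega

end Necessity

/-! ### The perturbation theorem -/

theorem rank_add_le_rank_add_rank {n : ℕ} (A B : Matrix (Fin n) (Fin n) ℂ) :
    (A + B).rank ≤ A.rank + B.rank := by
  have h : LinearMap.range (A + B).mulVecLin ≤
      LinearMap.range A.mulVecLin ⊔ LinearMap.range B.mulVecLin := by
    rintro _ ⟨x, rfl⟩
    rw [Matrix.mulVecLin_add]
    exact Submodule.add_mem_sup ⟨x, rfl⟩ ⟨x, rfl⟩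
  exact (Submodule.finrank_mono h).trans (Submodule.finrank_add_le_finrank_add_finrank _ _)

theorem rank_neg_eq_rank {n : ℕ} (A : Matrix (Fin n) (Fin n) ℂ) : (-A).rank = A.rank := by
  rw [Matrix.rank, ← Matrix.toLin'_apply', map_neg, LinearMap.range_neg]
  rfl

/-- Sufficiency of the bound: an intermediate characteristic at distance one is reached by a
perturbation of rank one, and the remaining distance `k - 1` by induction. -/
theorem exists_rank_le {n : ℕ} (k : ℕ) (A : Matrix (Fin n) (Fin n) ℂ) {η : ℕ+ → ℂ → ℕ}
    (hη : IsWeyrCharacteristic n η) (h1 : ∀ m c, weyr A m c ≤ η m c + k)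
    (h2 : ∀ m c, η m c ≤ weyr A m c + k) :
    ∃ R : Matrix (Fin n) (Fin n) ℂ, R.rank ≤ k ∧ weyr (A + R) = η := by
  induction k generalizing A with
  | zero =>
    refine ⟨0, Matrix.rank_zero.le, ?_⟩
    rw [add_zero]
    exact funext fun m => funext fun c => le_antisymm (h1 m c) (h2 m c)
  | succ k ih =>
    obtain ⟨γ, hγ, hα1, hα2, hβ1, hβ2⟩ :=
      exists_intermediate (isWeyrCharacteristic_weyr A) hη h1 h2
    obtain ⟨R₁, hR₁, rfl⟩ := exists_rank_le_one A hγ hα1 hα2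
    obtain ⟨R₂, hR₂, h⟩ := ih (A + R₁) hβ1 hβ2
    refine ⟨R₁ + R₂, (rank_add_le_rank_add_rank _ _).trans ?_,
      by rw [← add_assoc, h]⟩
    omega

theorem theorem2 (n k : ℕ) (A : Matrix (Fin n) (Fin n) ℂ) :
    {η : ℕ+ → ℂ → ℕ | ∃ R : Matrix (Fin n) (Fin n) ℂ, R.rank ≤ k ∧ weyr (A + R) = η} =
      {η : ℕ+ → ℂ → ℕ | IsWeyrCharacteristic n η ∧
        ∀ (m : ℕ+) (c : ℂ), |(weyr A m c : ℤ) - (η m c : ℤ)| ≤ (k : ℤ)} := by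
  ext η
  constructor
  · rintro ⟨R, hR, rfl⟩
    refine ⟨isWeyrCharacteristic_weyr _, fun m c => abs_le.2 ?_⟩
    have h1 := weyr_le_weyr_add_rank A R m c
    have h2 := weyr_le_weyr_add_rank (A + R) (-R) m c
    rw [add_neg_cancel_right, rank_neg_eq_rank] at h2
    omega
  · rintro ⟨hη, h⟩
    refine exists_rank_le k A hη (fun m c => ?_) fun m c => ?_ <;>
    · have := abs_le.1 (h m c)
      omega
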